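/- Let $n$ be a nonnegative integer, let $1<p\le 2$ and $r\ge 1$ be real numbers, and let $B$ be any complex $n\times n$ matrix (not necessarily invertible). For a positive semidefinite complex matrix $X$ and a real number $t>0$, let $X^{t}$ denote the positive semidefinite matrix obtained by applying $x\mapsto x^{t}$ to the eigenvalues of $X$. Then the map $$A\mapsto \operatorname{tr}\big[(B^{*}A^{p}B)^{r/p}\big]$$ is convex on the convex set of positive definite Hermitian $n\times n$ complex matrices. -/

import Mathlib

open scoped MatrixOrder ComplexOrder

/-!
Fix `K`. For `α, β ≥ 0` the quadratic form `⟪A K, (α L_A + β R_Z)⁻¹ A K⟫`, with `L_A` and `R_Z` the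
multiplications by `A` on the left and by `Z` on the right, is a supremum of real-linear functionals
of the pair `(A, Z)`, hence jointly convex. Integrating it against the measure in the integral
representation of `x ^ p` shows that `tr (Kᴴ A ^ p K Z ^ (1 - p))` is jointly convex for
`1 ≤ p ≤ 2`. For `Z = 1` this is the operator convexity of `A ↦ Bᴴ A ^ p B`.

If `f` is convex, then `tr f(M)` is the maximum over unitary `V` of `∑ i, f ((Vᴴ M V) i i)`
(Peierls), so `A ↦ tr f(Φ A)` is convex when `Φ` is and `f` is also monotone. This settles `r ≥ p`.

If `r < p`, put `σ = r / p` and `c = r (p - 1) / (p - r)`. Young's inequality gives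
`tr X ^ σ = inf_Z (σ tr (X Z ^ (1 - p)) + (1 - σ) tr Z ^ c)`. For `X = Bᴴ A ^ p B` the right-hand
side is jointly convex in `(A, Z)`, as `c ≥ 1` exactly when `r ≥ 1`, and a partial infimum of a
jointly convex function is convex.
-/

section

open Matrix MeasureTheory Set

section Convexity

variable {E F I : Type*} [AddCommMonoid E] [SMul ℝ E] [AddCommMonoid F] [SMul ℝ F]

lemma convexOn_of_isLUB {s : Set E} (hs : Convex ℝ s) {f : I → E → ℝ} {g : E → ℝ}
    (hf : ∀ i, ConvexOn ℝ s (f i)) (hg : ∀ x ∈ s, IsLUB (range fun i => f i x) (g x)) :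
    ConvexOn ℝ s g := by
  refine ⟨hs, fun x hx y hy a b ha hb hab => (hg _ (hs hx hy ha hb hab)).2 ?_⟩
  rintro _ ⟨i, rfl⟩
  calc f i (a • x + b • y) ≤ a • f i x + b • f i y := (hf i).2 hx hy ha hb hab
    _ ≤ a • g x + b • g y := by
      gcongr
      · exact (hg x hx).1 ⟨i, rfl⟩
      · exact (hg y hy).1 ⟨i, rfl⟩

lemma convexOn_of_isGLB {s : Set E} {t : Set F} (hs : Convex ℝ s) {f : E × F → ℝ} {g : E → ℝ}
    (hf : ConvexOn ℝ (s ×ˢ t) f) (hg : ∀ x ∈ s, IsGLB ((fun y => f (x, y)) '' t) (g x)) :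
    ConvexOn ℝ s g := by
  refine ⟨hs, fun x hx y hy a b ha hb hab => le_of_forall_pos_le_add fun ε hε => ?_⟩
  obtain ⟨_, ⟨u, hu, rfl⟩, -, hgu⟩ := (hg x hx).exists_between (lt_add_of_pos_right (g x) hε)
  obtain ⟨_, ⟨v, hv, rfl⟩, -, hgv⟩ := (hg y hy).exists_between (lt_add_of_pos_right (g y) hε)
  have hmem : (x, u) ∈ s ×ˢ t ∧ (y, v) ∈ s ×ˢ t := ⟨⟨hx, hu⟩, ⟨hy, hv⟩⟩
  calc g (a • x + b • y)
      ≤ f (a • (x, u) + b • (y, v)) :=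
        (hg _ (hs hx hy ha hb hab)).1 ⟨_, (hf.1 hmem.1 hmem.2 ha hb hab).2, rfl⟩
    _ ≤ a • f (x, u) + b • f (y, v) := hf.2 hmem.1 hmem.2 ha hb hab
    _ ≤ a • (g x + ε) + b • (g y + ε) := by gcongr
    _ = a • g x + b • g y + ε := by
      rw [smul_add, smul_add, add_add_add_comm, ← add_smul, hab, one_smul]

end Convexity

variable {𝕜 ι κ : Type*} [RCLike 𝕜]

lemma convex_setOf_posSemidef : Convex ℝ {A : Matrix ι ι 𝕜 | A.PosSemidef} :=
  fun _ hA _ hB _ _ ha hb _ => (hA.smul ha).add (hB.smul hb)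

lemma convex_setOf_posDef : Convex ℝ {A : Matrix ι ι 𝕜 | A.PosDef} := by
  intro A hA B hB a b ha hb hab
  rcases ha.eq_or_lt with rfl | ha
  · obtain rfl : b = 1 := by linarith
    simpa using hB
  · exact (hA.smul ha).add_posSemidef (hB.posSemidef.smul hb)

variable [Fintype ι]

lemma convexOn_re_conj_apply_self [Finite κ] {E : Type*} [AddCommMonoid E] [SMul ℝ E]
    {S : Set E} {Φ : E → Matrix ι ι 𝕜} (hΦ : ConvexOn ℝ S Φ) (V : Matrix ι κ 𝕜) (j : κ) :
    ConvexOn ℝ S fun x => RCLike.re ((Vᴴ * Φ x * V) j j) := by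
  refine ⟨hΦ.1, fun x hx y hy a b ha hb hab => ?_⟩
  have h := ((Matrix.le_iff.1 (hΦ.2 hx hy ha hb hab)).conjTranspose_mul_mul_same V).diag_nonneg
    (i := j)
  simpa [Matrix.mul_sub, Matrix.sub_mul, Matrix.mul_add, Matrix.add_mul, RCLike.smul_re] using
    (RCLike.nonneg_iff.1 h).1

variable [DecidableEq ι]

lemma cfc_eq_mul_diagonal_mul {A : Matrix ι ι 𝕜} (hA : A.IsHermitian) (f : ℝ → ℝ) :
    cfc f A = (hA.eigenvectorUnitary : Matrix ι ι 𝕜) *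
      diagonal (fun i => (f (hA.eigenvalues i) : 𝕜)) *
        star (hA.eigenvectorUnitary : Matrix ι ι 𝕜) := by
  rw [hA.cfc_eq, IsHermitian.cfc, Unitary.conjStarAlgAut_apply]
  rfl

lemma re_trace_cfc {A : Matrix ι ι 𝕜} (hA : A.IsHermitian) (f : ℝ → ℝ) :
    RCLike.re (trace (cfc f A)) = ∑ i, f (hA.eigenvalues i) := by
  rw [cfc_eq_mul_diagonal_mul hA, trace_mul_comm, ← mul_assoc]
  simp [trace_diagonal]

section Peierls

variable {M : Matrix ι ι 𝕜}

lemma norm_sq_mem_doublyStochastic {U : Matrix ι ι 𝕜} (hU : U ∈ unitaryGroup ι 𝕜) :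
    (of fun i j => ‖U i j‖ ^ 2) ∈ doublyStochastic ℝ ι := by
  have hrow {V : Matrix ι ι 𝕜} (hV : V * Vᴴ = 1) (i : ι) : ∑ j, ‖V i j‖ ^ 2 = 1 := by
    have h := congr(RCLike.re ($hV i i))
    simp only [mul_apply, conjTranspose_apply, RCLike.star_def, RCLike.mul_conj, map_sum,
      one_apply_eq, RCLike.one_re] at h
    exact_mod_cast h
  refine mem_doublyStochastic_iff_sum.2 ⟨fun i j => sq_nonneg _, fun i => ?_, fun j => ?_⟩
  · exact hrow (mem_unitaryGroup_iff.1 hU) i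
  · simpa using hrow (V := Uᴴ) (by simpa [star_eq_conjTranspose] using mem_unitaryGroup_iff'.1 hU) j

lemma re_conj_apply_self (hM : M.IsHermitian) (V : Matrix ι κ 𝕜) (j : κ) :
    RCLike.re ((Vᴴ * M * V) j j) =
      ∑ i, ‖(Vᴴ * (hM.eigenvectorUnitary : Matrix ι ι 𝕜)) j i‖ ^ 2 * hM.eigenvalues i := by
  set U := (hM.eigenvectorUnitary : Matrix ι ι 𝕜)
  have hspectral : M = U * diagonal (fun i => (hM.eigenvalues i : 𝕜)) * Uᴴ :=
    (cfc_id ℝ M hM.isSelfAdjoint).symm.trans (cfc_eq_mul_diagonal_mul hM id)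
  have hconj : Vᴴ * M * V = (Vᴴ * U) * (diagonal (fun i => (hM.eigenvalues i : 𝕜)) *
      (Vᴴ * U)ᴴ) := by
    conv_lhs => rw [hspectral]
    simp only [conjTranspose_mul, conjTranspose_conjTranspose, Matrix.mul_assoc]
  rw [hconj, mul_apply, map_sum]
  refine Finset.sum_congr rfl fun i _ => ?_
  rw [diagonal_mul, conjTranspose_apply, mul_left_comm, RCLike.re_ofReal_mul, RCLike.star_def,
    RCLike.mul_conj, mul_comm]
  norm_cast

lemma sum_map_diag_le_re_trace_cfc (hM : M.IsHermitian) {s : Set ℝ} {f : ℝ → ℝ}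
    (hf : ConvexOn ℝ s f) (hs : ∀ i, hM.eigenvalues i ∈ s) (V : unitaryGroup ι 𝕜) :
    ∑ i, f (RCLike.re (((V : Matrix ι ι 𝕜)ᴴ * M * V) i i)) ≤ RCLike.re (trace (cfc f M)) := by
  have hstoch := norm_sq_mem_doublyStochastic (star V * hM.eigenvectorUnitary).2
  calc ∑ i, f (RCLike.re (((V : Matrix ι ι 𝕜)ᴴ * M * V) i i))
      ≤ ∑ i, ∑ j, ‖((V : Matrix ι ι 𝕜)ᴴ * (hM.eigenvectorUnitary : Matrix ι ι 𝕜)) i j‖ ^ 2 *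
          f (hM.eigenvalues j) := by
        refine Finset.sum_le_sum fun i _ => ?_
        rw [re_conj_apply_self hM]
        exact hf.map_sum_le (fun j _ => sq_nonneg _) (sum_row_of_mem_doublyStochastic hstoch i)
          fun j _ => hs j
    _ = RCLike.re (trace (cfc f M)) := by
        rw [Finset.sum_comm, re_trace_cfc hM]
        refine Finset.sum_congr rfl fun j _ => ?_
        rw [← Finset.sum_mul]
        exact (congrArg (· * _) (sum_col_of_mem_doublyStochastic hstoch j)).trans (one_mul _)

lemma isGreatest_sum_map_diag (hM : M.IsHermitian) {s : Set ℝ} {f : ℝ → ℝ}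
    (hf : ConvexOn ℝ s f) (hs : ∀ i, hM.eigenvalues i ∈ s) :
    IsGreatest (range fun V : unitaryGroup ι 𝕜 =>
      ∑ i, f (RCLike.re (((V : Matrix ι ι 𝕜)ᴴ * M * V) i i))) (RCLike.re (trace (cfc f M))) := by
  refine ⟨⟨hM.eigenvectorUnitary, ?_⟩, ?_⟩
  · have hU : (hM.eigenvectorUnitary : Matrix ι ι 𝕜)ᴴ * hM.eigenvectorUnitary = 1 :=
      Unitary.coe_star_mul_self hM.eigenvectorUnitary
    simp [re_conj_apply_self hM, re_trace_cfc hM, hU, one_apply, apply_ite]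
  · rintro _ ⟨V, rfl⟩
    exact sum_map_diag_le_re_trace_cfc hM hf hs V

variable {E : Type*} [AddCommMonoid E] [SMul ℝ E] {S : Set E} {Φ : E → Matrix ι ι 𝕜}

theorem convexOn_re_trace_cfc (hΦ : ConvexOn ℝ S Φ) (hpos : ∀ x ∈ S, (Φ x).PosSemidef) {f : ℝ → ℝ}
    (hf : ConvexOn ℝ (Ici 0) f) (hmono : MonotoneOn f (Ici 0)) :
    ConvexOn ℝ S fun x => RCLike.re (trace (cfc f (Φ x))) := by
  have hdiag (V : unitaryGroup ι 𝕜) (i : ι) (x : E) (hx : x ∈ S) :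
      0 ≤ RCLike.re (((V : Matrix ι ι 𝕜)ᴴ * Φ x * V) i i) :=
    (RCLike.nonneg_iff.1 ((hpos x hx).conjTranspose_mul_mul_same _).diag_nonneg).1
  refine convexOn_of_isLUB hΦ.1 (fun V : unitaryGroup ι 𝕜 => ?_) fun x hx =>
    (isGreatest_sum_map_diag (hpos x hx).isHermitian hf (hpos x hx).eigenvalues_nonneg).isLUB
  refine ⟨hΦ.1, fun x hx y hy a b ha hb hab => ?_⟩
  rw [Finset.smul_sum, Finset.smul_sum, ← Finset.sum_add_distrib]
  refine Finset.sum_le_sum fun i _ => ?_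
  have hx0 := hdiag V i x hx
  have hy0 := hdiag V i y hy
  exact (hmono (hdiag V i _ (hΦ.1 hx hy ha hb hab)) (convex_Ici 0 hx0 hy0 ha hb hab)
    ((convexOn_re_conj_apply_self hΦ _ i).2 hx hy ha hb hab)).trans (hf.2 hx0 hy0 ha hb hab)

theorem convexOn_re_trace_rpow (hΦ : ConvexOn ℝ S Φ) (hpos : ∀ x ∈ S, (Φ x).PosSemidef)
    {c : ℝ} (hc : 1 ≤ c) : ConvexOn ℝ S fun x => RCLike.re (trace (Φ x ^ c)) :=
  (convexOn_re_trace_cfc hΦ hpos (convexOn_rpow hc)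
    fun _ hx _ _ hxy => Real.rpow_le_rpow hx hxy (by linarith)).congr fun x hx => by
      simp only [CFC.rpow_eq_cfc_real (hpos x hx).nonneg]

end Peierls

variable [Fintype κ]

section EigenSum

variable [DecidableEq κ] {A : Matrix ι ι 𝕜} {Z : Matrix κ κ 𝕜}

/-- The matrix of `K` in the eigenbases of the Hermitian matrices `A` (for the rows) and `Z` (for
the columns). -/
noncomputable def eigenCoeff (hA : A.IsHermitian) (hZ : Z.IsHermitian) (K : Matrix ι κ 𝕜) :
    Matrix ι κ 𝕜 :=
  star (hA.eigenvectorUnitary : Matrix ι ι 𝕜) * K * (hZ.eigenvectorUnitary : Matrix κ κ 𝕜)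

lemma eigenCoeff_surjective (hA : A.IsHermitian) (hZ : Z.IsHermitian) :
    Function.Surjective (eigenCoeff hA hZ) := by
  intro k
  refine ⟨(hA.eigenvectorUnitary : Matrix ι ι 𝕜) * k *
    star (hZ.eigenvectorUnitary : Matrix κ κ 𝕜), ?_⟩
  have hU := Unitary.coe_star_mul_self hA.eigenvectorUnitary
  have hV := Unitary.coe_star_mul_self hZ.eigenvectorUnitary
  rw [eigenCoeff, Matrix.mul_assoc, Matrix.mul_assoc, Matrix.mul_assoc, hV, Matrix.mul_one,
    ← Matrix.mul_assoc, hU, Matrix.one_mul]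

lemma re_trace_mul_cfc_mul_cfc (hA : A.IsHermitian) (hZ : Z.IsHermitian) (W K : Matrix ι κ 𝕜)
    (f g : ℝ → ℝ) :
    RCLike.re (trace (Wᴴ * cfc f A * K * cfc g Z)) =
      ∑ i, ∑ j, f (hA.eigenvalues i) * g (hZ.eigenvalues j) *
        RCLike.re (star (eigenCoeff hA hZ W i j) * eigenCoeff hA hZ K i j) := by
  have h : trace (Wᴴ * cfc f A * K * cfc g Z) =
      trace ((eigenCoeff hA hZ W)ᴴ * (diagonal (fun i => (f (hA.eigenvalues i) : 𝕜)) *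
        (eigenCoeff hA hZ K * diagonal (fun j => (g (hZ.eigenvalues j) : 𝕜))))) := by
    rw [cfc_eq_mul_diagonal_mul hA, cfc_eq_mul_diagonal_mul hZ, ← Matrix.mul_assoc, trace_mul_comm]
    simp only [eigenCoeff, conjTranspose_mul, star_eq_conjTranspose, conjTranspose_conjTranspose,
      Matrix.mul_assoc]
  rw [h, trace, Finset.sum_comm, map_sum]
  refine Finset.sum_congr rfl fun j _ => ?_
  rw [diag_apply, mul_apply, map_sum]
  refine Finset.sum_congr rfl fun i _ => ?_
  rw [diagonal_mul, mul_diagonal, conjTranspose_apply, ← RCLike.re_ofReal_mul]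
  push_cast
  ring_nf

/-- The sum `∑ i, ∑ j, h (a i) (z j) * |k i j| ^ 2` over the eigenvalues `a` of `A` and `z` of `Z`,
where `k` is `K` in the eigenbases. For `h x z = f x * g z` it is `tr (Kᴴ f(A) K g(Z))`; for
general `h` it is the quadratic form at `K` of `h` applied to the commuting operators
`K ↦ A * K` and `K ↦ K * Z`. -/
noncomputable def eigenSum (h : ℝ → ℝ → ℝ) (hA : A.IsHermitian) (hZ : Z.IsHermitian)
    (K : Matrix ι κ 𝕜) : ℝ :=
  ∑ i, ∑ j, h (hA.eigenvalues i) (hZ.eigenvalues j) * ‖eigenCoeff hA hZ K i j‖ ^ 2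

lemma re_trace_mul_cfc_mul_cfc_self (hA : A.IsHermitian) (hZ : Z.IsHermitian) (K : Matrix ι κ 𝕜)
    (f g : ℝ → ℝ) :
    RCLike.re (trace (Kᴴ * cfc f A * K * cfc g Z)) = eigenSum (fun x z => f x * g z) hA hZ K := by
  rw [re_trace_mul_cfc_mul_cfc hA hZ, eigenSum]
  refine Finset.sum_congr rfl fun i _ => Finset.sum_congr rfl fun j _ => ?_
  rw [RCLike.star_def, RCLike.conj_mul]
  norm_cast

lemma re_trace_mul_rpow_mul_rpow (hA : A.PosSemidef) (hZ : Z.PosSemidef) (K : Matrix ι κ 𝕜)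
    (s t : ℝ) :
    RCLike.re (trace (Kᴴ * A ^ s * K * Z ^ t)) =
      eigenSum (fun x z => x ^ s * z ^ t) hA.isHermitian hZ.isHermitian K := by
  rw [CFC.rpow_eq_cfc_real hA.nonneg, CFC.rpow_eq_cfc_real hZ.nonneg,
    re_trace_mul_cfc_mul_cfc_self hA.isHermitian hZ.isHermitian]

lemma eigenSum_const_mul (c : ℝ) (h : ℝ → ℝ → ℝ) (hA : A.IsHermitian) (hZ : Z.IsHermitian)
    (K : Matrix ι κ 𝕜) :
    eigenSum (fun x z => c * h x z) hA hZ K = c * eigenSum h hA hZ K := by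
  simp only [eigenSum, Finset.mul_sum, mul_assoc]

lemma eigenSum_add (h₁ h₂ : ℝ → ℝ → ℝ) (hA : A.IsHermitian) (hZ : Z.IsHermitian)
    (K : Matrix ι κ 𝕜) :
    eigenSum (fun x z => h₁ x z + h₂ x z) hA hZ K = eigenSum h₁ hA hZ K + eigenSum h₂ hA hZ K := by
  simp only [eigenSum, add_mul, Finset.sum_add_distrib]

lemma eigenSum_mono {h₁ h₂ : ℝ → ℝ → ℝ} (hA : A.IsHermitian) (hZ : Z.IsHermitian)
    (K : Matrix ι κ 𝕜)
    (h : ∀ i j, h₁ (hA.eigenvalues i) (hZ.eigenvalues j) ≤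
      h₂ (hA.eigenvalues i) (hZ.eigenvalues j)) :
    eigenSum h₁ hA hZ K ≤ eigenSum h₂ hA hZ K :=
  Finset.sum_le_sum fun i _ => Finset.sum_le_sum fun j _ =>
    mul_le_mul_of_nonneg_right (h i j) (sq_nonneg _)

section Integral

variable {T : Type*} [MeasurableSpace T] {μ : Measure T} {h : T → ℝ → ℝ → ℝ}

lemma integrable_eigenSum (hA : A.IsHermitian) (hZ : Z.IsHermitian) (K : Matrix ι κ 𝕜)
    (hint : ∀ i j, Integrable (fun t => h t (hA.eigenvalues i) (hZ.eigenvalues j)) μ) :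
    Integrable (fun t => eigenSum (h t) hA hZ K) μ :=
  integrable_finsetSum _ fun i _ => integrable_finsetSum _ fun j _ => (hint i j).mul_const _

lemma integral_eigenSum (hA : A.IsHermitian) (hZ : Z.IsHermitian) (K : Matrix ι κ 𝕜)
    (hint : ∀ i j, Integrable (fun t => h t (hA.eigenvalues i) (hZ.eigenvalues j)) μ) :
    ∫ t, eigenSum (h t) hA hZ K ∂μ = eigenSum (fun x z => ∫ t, h t x z ∂μ) hA hZ K := by
  simp only [eigenSum]
  rw [integral_finsetSum _ fun i _ => integrable_finsetSum _ fun j _ => (hint i j).mul_const _]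
  refine Finset.sum_congr rfl fun i _ => ?_
  rw [integral_finsetSum _ fun j _ => (hint i j).mul_const _]
  exact Finset.sum_congr rfl fun j _ => integral_mul_const _ _

end Integral

end EigenSum

section ResolventForm

/-- The real-linear functional of `(A, Z)` given by
`2 Re tr (Wᴴ A K) - α Re tr (Wᴴ A W) - β Re tr (Wᴴ W Z)`. -/
@[simps]
def dualForm (α β : ℝ) (K W : Matrix ι κ 𝕜) : Matrix ι ι 𝕜 × Matrix κ κ 𝕜 →ₗ[ℝ] ℝ where
  toFun P := 2 * RCLike.re (trace (Wᴴ * P.1 * K)) - α * RCLike.re (trace (Wᴴ * P.1 * W)) -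
    β * RCLike.re (trace (Wᴴ * W * P.2))
  map_add' P Q := by
    simp only [Prod.fst_add, Prod.snd_add, Matrix.mul_add, Matrix.add_mul, trace_add, map_add]
    ring
  map_smul' c P := by
    simp only [Prod.smul_fst, Prod.smul_snd, Matrix.mul_smul, Matrix.smul_mul, trace_smul,
      RCLike.smul_re, RingHom.id_apply, smul_eq_mul]
    ring

/-- The quadratic form `⟪A K, (α L_A + β R_Z)⁻¹ A K⟫` in its dual description, where `L_A` and
`R_Z` are the multiplications by `A` on the left and by `Z` on the right. Where the supremum is
infinite the value is the junk value `0`. -/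
noncomputable def resolventForm (α β : ℝ) (K : Matrix ι κ 𝕜)
    (P : Matrix ι ι 𝕜 × Matrix κ κ 𝕜) : ℝ :=
  ⨆ W, dualForm α β K W P

variable [DecidableEq κ] {A : Matrix ι ι 𝕜} {Z : Matrix κ κ 𝕜}

lemma two_mul_re_sub_mul_norm_sq (a : ℝ) {y : ℝ} (hy : y ≠ 0) (k w : 𝕜) :
    2 * (a * RCLike.re (star w * k)) - y * ‖w‖ ^ 2 =
      a ^ 2 / y * ‖k‖ ^ 2 - y * ‖w - (a / y : ℝ) * k‖ ^ 2 := by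
  have hre : RCLike.re (w * (starRingEnd 𝕜) ((a / y : ℝ) * k)) =
      a / y * RCLike.re (star w * k) := by
    rw [map_mul (starRingEnd 𝕜), RCLike.conj_ofReal, mul_left_comm, RCLike.re_ofReal_mul,
      ← RCLike.conj_re, map_mul (starRingEnd 𝕜), RCLike.conj_conj, RCLike.star_def]
  have hnorm : ‖((a / y : ℝ) : 𝕜) * k‖ ^ 2 = (a / y) ^ 2 * ‖k‖ ^ 2 := by
    rw [norm_mul, RCLike.norm_ofReal, mul_pow, sq_abs]
  have hsub : ‖w - (a / y : ℝ) * k‖ ^ 2 =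
      ‖w‖ ^ 2 + (a / y) ^ 2 * ‖k‖ ^ 2 - 2 * (a / y * RCLike.re (star w * k)) := by
    rw [← hnorm, ← hre]
    simp only [← RCLike.normSq_eq_def', RCLike.normSq_sub]
  rw [hsub]
  field_simp
  ring

lemma dualForm_eq_sum (α β : ℝ) (K W : Matrix ι κ 𝕜) (hA : A.IsHermitian) (hZ : Z.IsHermitian) :
    dualForm α β K W (A, Z) = ∑ i, ∑ j,
      (2 * (hA.eigenvalues i *
          RCLike.re (star (eigenCoeff hA hZ W i j) * eigenCoeff hA hZ K i j)) -
        (α * hA.eigenvalues i + β * hZ.eigenvalues j) * ‖eigenCoeff hA hZ W i j‖ ^ 2) := by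
  have hWAK := re_trace_mul_cfc_mul_cfc hA hZ W K id (fun _ => 1)
  have hWAW := re_trace_mul_cfc_mul_cfc_self hA hZ W id (fun _ => 1)
  have hWWZ := re_trace_mul_cfc_mul_cfc_self hA hZ W (fun _ => 1) id
  rw [cfc_id ℝ A hA.isSelfAdjoint, cfc_const_one ℝ Z hZ.isSelfAdjoint, Matrix.mul_one]
    at hWAK hWAW
  rw [cfc_const_one ℝ A hA.isSelfAdjoint, cfc_id ℝ Z hZ.isSelfAdjoint, Matrix.mul_one] at hWWZ
  simp only [dualForm_apply, hWAK, hWAW, hWWZ, eigenSum, Finset.mul_sum, ← Finset.sum_sub_distrib,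
    id]
  refine Finset.sum_congr rfl fun i _ => Finset.sum_congr rfl fun j _ => ?_
  ring

lemma isGreatest_range_dualForm {α β : ℝ} (hα : 0 ≤ α) (hβ : 0 < β) (K : Matrix ι κ 𝕜)
    (hA : A.PosSemidef) (hZ : Z.PosDef) :
    IsGreatest (range fun W => dualForm α β K W (A, Z))
      (eigenSum (fun x z => x ^ 2 / (α * x + β * z)) hA.isHermitian hZ.isHermitian K) := by
  set a := hA.isHermitian.eigenvalues
  set z := hZ.isHermitian.eigenvalues
  set coeff := eigenCoeff hA.isHermitian hZ.isHermitian
  have hpos (i : ι) (j : κ) : 0 < α * a i + β * z j :=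
    add_pos_of_nonneg_of_pos (mul_nonneg hα (hA.eigenvalues_nonneg i))
      (mul_pos hβ (hZ.eigenvalues_pos j))
  have hsum (W : Matrix ι κ 𝕜) : dualForm α β K W (A, Z) = ∑ i, ∑ j,
      (a i ^ 2 / (α * a i + β * z j) * ‖coeff K i j‖ ^ 2 - (α * a i + β * z j) *
        ‖coeff W i j - (a i / (α * a i + β * z j) : ℝ) * coeff K i j‖ ^ 2) :=
    (dualForm_eq_sum α β K W _ _).trans <| Finset.sum_congr rfl fun i _ =>
      Finset.sum_congr rfl fun j _ => two_mul_re_sub_mul_norm_sq _ (hpos i j).ne' _ _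
  constructor
  · obtain ⟨W, hW⟩ := eigenCoeff_surjective hA.isHermitian hZ.isHermitian
      (of fun i j => ((a i / (α * a i + β * z j) : ℝ) : 𝕜) * coeff K i j)
    refine ⟨W, (hsum W).trans ?_⟩
    simp [coeff, hW, eigenSum, a, z]
  · rintro _ ⟨W, rfl⟩
    refine (hsum W).trans_le (Finset.sum_le_sum fun i _ => Finset.sum_le_sum fun j _ => ?_)
    exact sub_le_self _ (mul_nonneg (hpos i j).le (sq_nonneg _))

lemma resolventForm_eq_eigenSum {α β : ℝ} (hα : 0 ≤ α) (hβ : 0 < β) (K : Matrix ι κ 𝕜)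
    (hA : A.PosSemidef) (hZ : Z.PosDef) :
    resolventForm α β K (A, Z) =
      eigenSum (fun x z => x ^ 2 / (α * x + β * z)) hA.isHermitian hZ.isHermitian K :=
  (isGreatest_range_dualForm hα hβ K hA hZ).csSup_eq

omit [DecidableEq ι] [DecidableEq κ] in
lemma convexOn_resolventForm {α β : ℝ} (hα : 0 ≤ α) (hβ : 0 < β) (K : Matrix ι κ 𝕜) :
    ConvexOn ℝ ({A : Matrix ι ι 𝕜 | A.PosSemidef} ×ˢ {Z : Matrix κ κ 𝕜 | Z.PosDef})
      (resolventForm α β K) := by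
  classical
  have hdom := (convex_setOf_posSemidef (ι := ι) (𝕜 := 𝕜)).prod
    (convex_setOf_posDef (ι := κ) (𝕜 := 𝕜))
  exact convexOn_of_isLUB hdom (fun W => (dualForm α β K W).convexOn hdom)
    fun P hP => isLUB_ciSup (isGreatest_range_dualForm hα hβ K hP.1 hP.2).bddAbove

end ResolventForm

section Power

variable {p : ℝ}

-- The factor `1 * x` makes the integrand literally that of `resolventForm 1 t`.
lemma exists_measure_rpow_mul_rpow_eq_integral (hp : p ∈ Ioo 1 2) :
    ∃ μ : Measure ℝ, ∀ x z : ℝ, 0 ≤ x → 0 < z →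
      IntegrableOn (fun t => t ^ (p - 2) * (x ^ 2 / (1 * x + t * z))) (Ioi 0) μ ∧
      ∫ t in Ioi 0, t ^ (p - 2) * (x ^ 2 / (1 * x + t * z)) ∂μ = x ^ p * z ^ (1 - p) := by
  obtain ⟨μ, hμ⟩ := Real.exists_measure_rpow_eq_integral_rpowIntegrand₁₂ hp
  refine ⟨μ, fun x z hx hz => ?_⟩
  obtain ⟨hint, hpow⟩ := hμ (x / z) (mem_Ici.2 (by positivity))
  have hcongr : EqOn (fun t => z * Real.rpowIntegrand₁₂ p t (x / z))
      (fun t => t ^ (p - 2) * (x ^ 2 / (1 * x + t * z))) (Ioi 0) := by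
    intro t (ht : 0 < t)
    have ht_pow : t ^ (p - 1) = t ^ (p - 2) * t := by
      rw [← Real.rpow_add_one ht.ne']; ring_nf
    have : x + t * z ≠ 0 := by positivity
    simp only [Real.rpowIntegrand₁₂, ht_pow]
    field_simp
    ring
  refine ⟨IntegrableOn.congr_fun (hint.const_mul z) hcongr measurableSet_Ioi, ?_⟩
  rw [← setIntegral_congr_fun measurableSet_Ioi hcongr, integral_const_mul, ← hpow,
    Real.div_rpow hx hz.le, Real.rpow_sub hz, Real.rpow_one]
  field_simp

section JointConvexity

variable [DecidableEq κ]

lemma convexOn_re_trace_mul_rpow_mul_rpow_of_mem_Ioo (hp : p ∈ Ioo 1 2) (K : Matrix ι κ 𝕜) :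
    ConvexOn ℝ ({A : Matrix ι ι 𝕜 | A.PosSemidef} ×ˢ {Z : Matrix κ κ 𝕜 | Z.PosDef})
      fun P => RCLike.re (trace (Kᴴ * P.1 ^ p * K * P.2 ^ (1 - p))) := by
  obtain ⟨μ, hμ⟩ := exists_measure_rpow_mul_rpow_eq_integral hp
  let kernel (t x z : ℝ) := t ^ (p - 2) * (x ^ 2 / (1 * x + t * z))
  have heq {A : Matrix ι ι 𝕜} {Z : Matrix κ κ 𝕜} (hA : A.PosSemidef) (hZ : Z.PosDef) :
      EqOn (fun t => eigenSum (kernel t) hA.isHermitian hZ.isHermitian K)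
        (fun t => t ^ (p - 2) * resolventForm 1 t K (A, Z)) (Ioi 0) := fun t ht => by
    simp only [kernel, eigenSum_const_mul, resolventForm_eq_eigenSum zero_le_one ht K hA hZ]
  have hint {A : Matrix ι ι 𝕜} {Z : Matrix κ κ 𝕜} (hA : A.PosSemidef) (hZ : Z.PosDef)
      (i : ι) (j : κ) := hμ _ _ (hA.eigenvalues_nonneg i) (hZ.eigenvalues_pos j)
  refine (integral_convexOn_of_integrand_ae (μ := μ.restrict (Ioi 0))
    (f := fun t P => t ^ (p - 2) * resolventForm 1 t K P) ?_ ?_ ?_).congr ?_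
  · exact convex_setOf_posSemidef.prod convex_setOf_posDef
  · filter_upwards [ae_restrict_mem measurableSet_Ioi] with t ht
    exact (convexOn_resolventForm zero_le_one ht K).smul (Real.rpow_nonneg (le_of_lt ht) _)
  · rintro ⟨A, Z⟩ ⟨hA, hZ⟩
    refine IntegrableOn.congr_fun ?_ (heq hA hZ) measurableSet_Ioi
    exact integrable_eigenSum (h := kernel) _ _ K fun i j => (hint hA hZ i j).1
  · rintro ⟨A, Z⟩ ⟨hA, hZ⟩
    dsimp only
    rw [← setIntegral_congr_fun measurableSet_Ioi (heq hA hZ),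
      integral_eigenSum (h := kernel) _ _ K fun i j => (hint hA hZ i j).1,
      re_trace_mul_rpow_mul_rpow hA hZ.posSemidef]
    exact Finset.sum_congr rfl fun i _ => Finset.sum_congr rfl fun j _ => by
      simp only [kernel, (hint hA hZ i j).2]

theorem convexOn_re_trace_mul_rpow_mul_rpow (hp : p ∈ Icc 1 2) (K : Matrix ι κ 𝕜) :
    ConvexOn ℝ ({A : Matrix ι ι 𝕜 | A.PosSemidef} ×ˢ {Z : Matrix κ κ 𝕜 | Z.PosDef})
      fun P => RCLike.re (trace (Kᴴ * P.1 ^ p * K * P.2 ^ (1 - p))) := by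
  rcases hp.1.eq_or_lt with rfl | hp₁
  · refine ((dualForm 1 0 K K).convexOn (convex_setOf_posSemidef.prod convex_setOf_posDef)).congr ?_
    rintro ⟨A, Z⟩ ⟨hA, hZ⟩
    simp only [dualForm_apply, sub_self, CFC.rpow_one A (PosSemidef.nonneg hA),
      CFC.rpow_zero Z (PosSemidef.nonneg hZ.posSemidef), Matrix.mul_one]
    ring
  rcases hp.2.eq_or_lt with rfl | hp₂
  · refine (convexOn_resolventForm le_rfl one_pos K).congr ?_
    rintro ⟨A, Z⟩ ⟨hA, hZ⟩
    refine (resolventForm_eq_eigenSum le_rfl one_pos K hA hZ).trans ?_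
    refine .trans ?_ (re_trace_mul_rpow_mul_rpow hA hZ.posSemidef K 2 (1 - 2)).symm
    congr! 3 with x z
    norm_num [Real.rpow_neg_one, div_eq_mul_inv]
  · exact convexOn_re_trace_mul_rpow_mul_rpow_of_mem_Ioo ⟨hp₁, hp₂⟩ K

end JointConvexity

omit [Fintype κ] in
lemma posSemidef_conjTranspose_mul_rpow_mul [Finite κ] (A : Matrix ι ι 𝕜) (B : Matrix ι κ 𝕜)
    (p : ℝ) :
    (Bᴴ * A ^ p * B).PosSemidef :=
  (nonneg_iff_posSemidef.1 CFC.rpow_nonneg).conjTranspose_mul_mul_same B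

omit [Fintype κ] in
lemma convexOn_conjTranspose_mul_rpow_mul [Finite κ] (hp : p ∈ Icc 1 2) (B : Matrix ι κ 𝕜) :
    ConvexOn ℝ {A : Matrix ι ι 𝕜 | A.PosSemidef} fun A => Bᴴ * A ^ p * B := by
  cases nonempty_fintype κ
  refine ⟨convex_setOf_posSemidef, fun A₁ hA₁ A₂ hA₂ a b ha hb hab => ?_⟩
  have hherm (A : Matrix ι ι 𝕜) := (posSemidef_conjTranspose_mul_rpow_mul A B p).isHermitian
  have hdiff := (((hherm A₁).smul (IsSelfAdjoint.all a)).add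
    ((hherm A₂).smul (IsSelfAdjoint.all b))).sub (hherm (a • A₁ + b • A₂))
  refine Matrix.le_iff.2 (.of_dotProduct_mulVec_nonneg hdiff fun x => ?_)
  refine RCLike.nonneg_iff.2 ⟨?_, hdiff.im_star_dotProduct_mulVec_self x⟩
  let K : Matrix ι Unit 𝕜 := B * replicateCol Unit x
  have hconv := (convexOn_re_trace_mul_rpow_mul_rpow hp K).2 (x := (A₁, 1)) (y := (A₂, 1))
    ⟨hA₁, .one⟩ ⟨hA₂, .one⟩ ha hb hab
  have htrace (A : Matrix ι ι 𝕜) : trace (Kᴴ * A ^ p * K) = star x ⬝ᵥ (Bᴴ * A ^ p * B) *ᵥ x := by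
    have hK : Kᴴ * A ^ p * K =
        replicateRow Unit (star x) * replicateCol Unit ((Bᴴ * A ^ p * B) *ᵥ x) := by
      simp only [K, conjTranspose_mul, conjTranspose_replicateCol, replicateCol_mulVec,
        Matrix.mul_assoc]
    rw [hK, trace_mul_comm, trace_replicateCol_mul_replicateRow, dotProduct_comm]
  simp only [Prod.smul_mk, Prod.mk_add_mk, ← add_smul, hab, one_smul, CFC.one_rpow,
    Matrix.mul_one, htrace] at hconv
  simp only [sub_mulVec, add_mulVec, smul_mulVec, dotProduct_sub, dotProduct_add, dotProduct_smul,
    map_sub, map_add, RCLike.smul_re, sub_nonneg]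
  exact hconv

end Power

section Young

open Filter Topology

variable {σ q c : ℝ}

lemma rpow_le_mul_rpow_neg_add_rpow {x z : ℝ} (hx : 0 ≤ x) (hz : 0 < z) (hσ : σ ∈ Icc 0 1)
    (hc : c * (1 - σ) = q * σ) : x ^ σ ≤ σ * (x * z ^ (-q)) + (1 - σ) * z ^ c := by
  have hcancel : (z ^ (-q)) ^ σ * (z ^ c) ^ (1 - σ) = 1 := by
    rw [← Real.rpow_mul hz.le, ← Real.rpow_mul hz.le, ← Real.rpow_add hz, hc, neg_mul,
      neg_add_cancel, Real.rpow_zero]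
  calc x ^ σ = (x * z ^ (-q)) ^ σ * (z ^ c) ^ (1 - σ) := by
        rw [Real.mul_rpow hx (by positivity), mul_assoc, hcancel, mul_one]
    _ ≤ σ * (x * z ^ (-q)) + (1 - σ) * z ^ c :=
      Real.geom_mean_le_arith_mean2_weighted hσ.1 (sub_nonneg.2 hσ.2) (by positivity)
        (by positivity) (by ring)

lemma mul_rpow_neg_add_rpow_le {x ε : ℝ} (hx : 0 ≤ x) (hε : 0 < ε) (hσ : 0 ≤ σ) (hc₀ : c ≠ 0)
    (hc : c * (1 - σ) = q * σ) :
    σ * (x * ((x + ε) ^ (σ / c)) ^ (-q)) + (1 - σ) * ((x + ε) ^ (σ / c)) ^ c ≤ (x + ε) ^ σ := by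
  have hxε : 0 < x + ε := by positivity
  have hzc : ((x + ε) ^ (σ / c)) ^ c = (x + ε) ^ σ := by
    rw [← Real.rpow_mul hxε.le, div_mul_cancel₀ σ hc₀]
  have hzq : (x + ε) * ((x + ε) ^ (σ / c)) ^ (-q) = (x + ε) ^ σ := by
    have hexp : σ / c * -q = σ - 1 := by
      field_simp
      linarith
    rw [← Real.rpow_mul hxε.le, hexp, Real.rpow_sub_one hxε.ne', mul_div_cancel₀ _ hxε.ne']
  calc σ * (x * ((x + ε) ^ (σ / c)) ^ (-q)) + (1 - σ) * ((x + ε) ^ (σ / c)) ^ c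
      ≤ σ * ((x + ε) * ((x + ε) ^ (σ / c)) ^ (-q)) + (1 - σ) * ((x + ε) ^ (σ / c)) ^ c := by
        gcongr
        exact le_add_of_nonneg_right hε.le
    _ = (x + ε) ^ σ := by
      rw [hzq, hzc]
      ring

variable {X : Matrix ι ι 𝕜}

lemma re_trace_rpow_le_mul_rpow_neg_add_rpow {Z : Matrix ι ι 𝕜} (hX : X.PosSemidef)
    (hZ : Z.PosDef) (hσ : σ ∈ Icc 0 1) (hc : c * (1 - σ) = q * σ) :
    RCLike.re (trace (X ^ σ)) ≤
      σ * RCLike.re (trace (X * Z ^ (-q))) + (1 - σ) * RCLike.re (trace (Z ^ c)) := by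
  have hsum (s t : ℝ) := re_trace_mul_rpow_mul_rpow hX hZ.posSemidef 1 s t
  simp only [conjTranspose_one, Matrix.one_mul, Matrix.mul_one] at hsum
  have hXσ := hsum σ 0
  have hXZ := hsum 1 (-q)
  have hZc := hsum 0 c
  simp only [CFC.rpow_zero Z hZ.posSemidef.nonneg, CFC.rpow_one X hX.nonneg,
    CFC.rpow_zero X hX.nonneg, Real.rpow_zero, Real.rpow_one, one_mul, mul_one] at hXσ hXZ hZc
  rw [hXσ, hXZ, hZc, ← eigenSum_const_mul, ← eigenSum_const_mul, ← eigenSum_add]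
  exact eigenSum_mono _ _ _ fun i j =>
    rpow_le_mul_rpow_neg_add_rpow (hX.eigenvalues_nonneg i) (hZ.eigenvalues_pos j) hσ hc

lemma exists_posDef_mul_rpow_neg_add_rpow_le (hX : X.PosSemidef) (hσ : σ ∈ Icc 0 1) (hc₀ : c ≠ 0)
    (hc : c * (1 - σ) = q * σ) {ε : ℝ} (hε : 0 < ε) :
    ∃ Z : Matrix ι ι 𝕜, Z.PosDef ∧
      σ * RCLike.re (trace (X * Z ^ (-q))) + (1 - σ) * RCLike.re (trace (Z ^ c)) ≤
        ∑ i, (hX.isHermitian.eigenvalues i + ε) ^ σ := by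
  have hcont (f : ℝ → ℝ) : ContinuousOn f (spectrum ℝ X) := X.finite_real_spectrum.continuousOn f
  have hXsa : IsSelfAdjoint X := hX.isHermitian.isSelfAdjoint
  let g (x : ℝ) := (x + ε) ^ (σ / c)
  have hg : ∀ x ∈ spectrum ℝ X, 0 < g x := fun x hx =>
    Real.rpow_pos_of_pos (add_pos_of_nonneg_of_pos (spectrum_nonneg_of_nonneg hX.nonneg hx) hε) _
  have hgpow (y : ℝ) : cfc g X ^ y = cfc (fun x => g x ^ y) X := CFC.cfc_rpow hg (hcont g) hXsa
  have hmul : X * cfc (fun x => g x ^ (-q)) X = cfc (fun x => x * g x ^ (-q)) X := by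
    rw [cfc_mul (fun x => x) _ X (hcont _) (hcont _), cfc_id' ℝ X hXsa]
  refine ⟨cfc g X, ((cfc_isStrictlyPositive_iff g X (hcont g) hXsa).2 hg).posDef, ?_⟩
  rw [hgpow, hgpow, hmul, re_trace_cfc hX.isHermitian, re_trace_cfc hX.isHermitian,
    Finset.mul_sum, Finset.mul_sum, ← Finset.sum_add_distrib]
  refine Finset.sum_le_sum fun i _ => ?_
  exact mul_rpow_neg_add_rpow_le (hX.eigenvalues_nonneg i) hε hσ.1 hc₀ hc

lemma isGLB_mul_rpow_neg_add_rpow (hX : X.PosSemidef) (hσ : σ ∈ Icc 0 1) (hc₀ : c ≠ 0)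
    (hc : c * (1 - σ) = q * σ) :
    IsGLB ((fun Z : Matrix ι ι 𝕜 =>
        σ * RCLike.re (trace (X * Z ^ (-q))) + (1 - σ) * RCLike.re (trace (Z ^ c))) ''
      {Z | Z.PosDef}) (RCLike.re (trace (X ^ σ))) := by
  constructor
  · rintro _ ⟨Z, hZ, rfl⟩
    exact re_trace_rpow_le_mul_rpow_neg_add_rpow hX hZ hσ hc
  intro b hb
  have hlim : Tendsto (fun ε : ℝ => ∑ i, (hX.isHermitian.eigenvalues i + ε) ^ σ) (𝓝[>] 0)
      (𝓝 (RCLike.re (trace (X ^ σ)))) := by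
    rw [CFC.rpow_eq_cfc_real hX.nonneg, re_trace_cfc hX.isHermitian]
    have hcont : Continuous fun ε : ℝ => ∑ i, (hX.isHermitian.eigenvalues i + ε) ^ σ :=
      continuous_finsetSum _ fun i _ =>
        (continuous_const.add continuous_id).rpow_const fun _ => .inr hσ.1
    simpa using (hcont.tendsto 0).mono_left nhdsWithin_le_nhds
  refine ge_of_tendsto hlim (eventually_of_mem self_mem_nhdsWithin fun ε hε => ?_)
  obtain ⟨Z, hZ, hle⟩ := exists_posDef_mul_rpow_neg_add_rpow_le hX hσ hc₀ hc hε
  exact (hb ⟨Z, hZ, rfl⟩).trans hle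

end Young

section ConvexTrace

variable [DecidableEq κ] {p r : ℝ}

lemma convexOn_re_trace_conj_rpow_of_le (hp : p ∈ Icc 1 2) (hpr : p ≤ r) (B : Matrix ι κ 𝕜) :
    ConvexOn ℝ {A : Matrix ι ι 𝕜 | A.PosSemidef}
      fun A => RCLike.re (trace ((Bᴴ * A ^ p * B) ^ (r / p))) :=
  convexOn_re_trace_rpow (convexOn_conjTranspose_mul_rpow_mul hp B)
    (fun A _ => posSemidef_conjTranspose_mul_rpow_mul A B p)
    ((one_le_div (by linarith [hp.1])).2 hpr)

lemma convexOn_mul_rpow_neg_add_rpow {σ c : ℝ} (hp : p ∈ Icc 1 2) (hσ : σ ∈ Icc 0 1)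
    (hc : 1 ≤ c) (B : Matrix ι κ 𝕜) :
    ConvexOn ℝ ({A : Matrix ι ι 𝕜 | A.PosSemidef} ×ˢ {Z : Matrix κ κ 𝕜 | Z.PosDef}) fun P =>
      σ * RCLike.re (trace (Bᴴ * P.1 ^ p * B * P.2 ^ (1 - p))) +
        (1 - σ) * RCLike.re (trace (P.2 ^ c)) := by
  have hjoint := convexOn_re_trace_mul_rpow_mul_rpow hp B
  have hid : ConvexOn ℝ {Z : Matrix κ κ 𝕜 | Z.PosDef} fun Z => Z :=
    convexOn_id convex_setOf_posDef
  have hpow := convexOn_re_trace_rpow hid (fun _ hZ => PosDef.posSemidef hZ) hc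
  have hsnd := (hpow.comp_linearMap (LinearMap.snd ℝ (Matrix ι ι 𝕜) _)).subset
    (fun _ hP => hP.2) hjoint.1
  exact (hjoint.smul hσ.1).add (hsnd.smul (sub_nonneg.2 hσ.2))

lemma convexOn_re_trace_conj_rpow_of_lt (hp : p ∈ Icc 1 2) (hr : 1 ≤ r) (hrp : r < p)
    (B : Matrix ι κ 𝕜) :
    ConvexOn ℝ {A : Matrix ι ι 𝕜 | A.PosSemidef}
      fun A => RCLike.re (trace ((Bᴴ * A ^ p * B) ^ (r / p))) := by
  have hp₀ : 0 < p := by linarith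
  have hpr : 0 < p - r := by linarith
  have hσ : r / p ∈ Icc 0 1 := ⟨by positivity, (div_le_one hp₀).2 hrp.le⟩
  set c := r * (p - 1) / (p - r) with hc_def
  have hc : c * (1 - r / p) = (p - 1) * (r / p) := by
    rw [hc_def]
    field_simp
  have hc₁ : 1 ≤ c := by
    rw [hc_def, le_div_iff₀ hpr]
    nlinarith
  have hX (A : Matrix ι ι 𝕜) : (Bᴴ * A ^ p * B).PosSemidef :=
    posSemidef_conjTranspose_mul_rpow_mul A B p
  have hjoint := convexOn_mul_rpow_neg_add_rpow hp hσ hc₁ B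
  refine convexOn_of_isGLB convex_setOf_posSemidef hjoint fun A _ => ?_
  have hinf := isGLB_mul_rpow_neg_add_rpow (hX A) hσ (zero_lt_one.trans_le hc₁).ne' hc
  simp only [neg_sub] at hinf
  exact hinf

theorem corollary4p6_general (hp : p ∈ Icc 1 2) (hr : 1 ≤ r) (B : Matrix ι κ 𝕜) :
    ConvexOn ℝ {A : Matrix ι ι 𝕜 | A.PosSemidef}
      fun A => RCLike.re (trace ((Bᴴ * A ^ p * B) ^ (r / p))) := by
  rcases le_or_gt p r with hpr | hrp
  · exact convexOn_re_trace_conj_rpow_of_le hp hpr B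
  · exact convexOn_re_trace_conj_rpow_of_lt hp hr hrp B

end ConvexTrace

end

/-- Powers `X ^ (t : ℝ)` of a positive semidefinite matrix are Mathlib's real powers of the
continuous functional calculus (apply `x ↦ x ^ t` to the eigenvalues). The matrix inside the trace
is positive semidefinite, so its trace is real and `.re` only changes the type to `ℝ`. -/
theorem corollary4p6 (n : ℕ) (p r : ℝ) (hp₁ : 1 < p) (hp₂ : p ≤ 2) (hr : 1 ≤ r)
    (B : Matrix (Fin n) (Fin n) ℂ) :
    ConvexOn ℝ {A : Matrix (Fin n) (Fin n) ℂ | A.PosDef}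
      (fun A : Matrix (Fin n) (Fin n) ℂ =>
        (Matrix.trace ((B.conjTranspose * A ^ p * B) ^ (r / p))).re) :=
  (corollary4p6_general ⟨hp₁.le, hp₂⟩ hr B).subset (fun _ hA => hA.posSemidef)
    convex_setOf_posDef
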